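/- For integers $p\ge 1$ and $n\ge 0$ let $A_n^p=\frac{1}{pn+1}\binom{pn+1}{n}$ be the Fuss-Catalan number. A set partition of $[n]=\{1,\dots,n\}$ is called planar (noncrossing) if its standard diagram has no two crossing arcs; here $(i,j)$ with $i<j$ is an arc if $i$ and $j$ lie in the same block and no element of that block lies strictly between them, and arcs $(i,j)$, $(k,l)$ cross if $i<k<j<l$. A partition $P$ is a refinement of $Q$ if each block of $P$ is contained in a block of $Q$. Then for every integer $m>1$ and every integer $n\ge 0$, the number of ordered $(m-1)$-tuples $(P_1,\dots,P_{m-1})$ of planar partitions of $[n]$ such that $P_i$ is a refinement of $P_{i+1}$ for each $1\le i<m-1$ (that is, the multichains with $m-1$ members in the lattice of noncrossing partitions of $[n]$) is exactly $A_n^m$. -/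

import Mathlib

/-- The Fuss-Catalan number `A_n^p = 1 / (p n + 1) * binom (p n + 1) n`, as a rational number. -/
def fussCatalan (p n : ℕ) : ℚ :=
  1 / ((p : ℚ) * n + 1) * (Nat.choose (p * n + 1) n : ℚ)

/-- `(i, j)` is an arc of the standard diagram of the partition `P`: `i < j` lie in the same block,
and no element of that block lies strictly between them. -/
def IsArc {s : Finset ℕ} (P : Finpartition s) (i j : ℕ) : Prop :=
  ∃ B ∈ P.parts, i ∈ B ∧ j ∈ B ∧ i < j ∧ ∀ k ∈ B, ¬ (i < k ∧ k < j)

/-- A partition is planar (noncrossing) if no two arcs `(i, j)` and `(k, l)` of its standard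
diagram cross, where crossing means `i < k < j < l`. -/
def IsPlanar {s : Finset ℕ} (P : Finpartition s) : Prop :=
  ∀ i j k l : ℕ, IsArc P i j → IsArc P k l → ¬ (i < k ∧ k < j ∧ j < l)

/-- A `k`-tuple planar partition of `[n] = {1, …, n}`: an ordered `k`-tuple of planar partitions
of `[n]`, each one (but the last) being a refinement of the next one. The order `≤` of
`Finpartition` is refinement: every block of the first is contained in a block of the second. -/
structure TuplePlanarPartition (k n : ℕ) where
  part : Fin k → Finpartition (Finset.Icc 1 n)
  planar : ∀ i, IsPlanar (part i)
  refines : ∀ i j : Fin k, (i : ℕ) + 1 = j → part i ≤ part j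

/-! Put k = m - 1 and let C be the generating function of chains of k noncrossing equivalence
relations on n ordered points. Let T_s be that of chains on n + 1 points whose levels t ≥ s relate
the last two points. For s = 0 the last point is redundant, so T_0 = C (`card_tiedChain_zero`). For
s < k, cut at the largest i - 1 < n related to n at level s: the points below i together with n
carry a chain tied from level s on, and [i, n) carries an arbitrary chain, so T_{s+1} = T_s C
(`card_tiedChain_succ`). Hence T_s = C^{s+1}. At s = k the tie is void and T_k counts all chains on
n + 1 points, so C = 1 + X C^m (`mk_chainCount`). The coefficients follow from
`coeff_pow_of_eq_one_add_X_mul_pow`, and `card_tuplePlanarPartition` returns to partitions. -/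

/-! ### Chains of noncrossing equivalence relations. -/

/-- `r t` for `t < k` are equivalence relations on `S`, each contained in the next one, whose
classes do not cross. -/
structure IsNCChain (k : ℕ) (S : Finset ℕ) (r : ℕ → ℕ → ℕ → Prop) : Prop where
  supp : ∀ {t a b}, r t a b → t < k ∧ a ∈ S ∧ b ∈ S
  refl : ∀ {t a}, t < k → a ∈ S → r t a a
  symm : ∀ {t a b}, r t a b → r t b a
  trans : ∀ {t a b c}, r t a b → r t b c → r t a c
  noncross : ∀ {t a b c d}, r t a c → r t b d → a < b → b < c → c < d → r t a b
  mono : ∀ {t u a b}, r t a b → t ≤ u → u < k → r u a b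

/-- The last two elements of `S` are related at the levels `t ≥ s`. -/
def IsTied (k s : ℕ) (S : Finset ℕ) (r : ℕ → ℕ → ℕ → Prop) : Prop :=
  ∀ t x y, s ≤ t → t < k → x ∈ S → y ∈ S → x < y → (∀ z ∈ S, z ≤ x ∨ z = y) → r t x y

/-- Chains on `S` whose members from level `s` on relate the last two elements of `S`. -/
abbrev TiedChain (k s : ℕ) (S : Finset ℕ) : Type :=
  {r : ℕ → ℕ → ℕ → Prop // IsNCChain k S r ∧ IsTied k s S r}

instance finite_tiedChain (k s : ℕ) (S : Finset ℕ) : Finite (TiedChain k s S) := by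
  have : Finite {A : Set (ℕ × ℕ × ℕ) // A ⊆ (Finset.range k ×ˢ S ×ˢ S : Finset (ℕ × ℕ × ℕ))} :=
    (Finset.finite_toSet _).finite_subsets.to_subtype
  refine Finite.of_injective
    (β := {A : Set (ℕ × ℕ × ℕ) // A ⊆ (Finset.range k ×ˢ S ×ˢ S : Finset (ℕ × ℕ × ℕ))})
    (fun r => ⟨{p | r.1 p.1 p.2.1 p.2.2}, ?_⟩) ?_
  · rintro ⟨t, a, b⟩ h
    simpa using r.2.1.supp h
  · intro r r' h
    apply Subtype.ext
    funext t a b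
    have := congrArg (fun A => (t, a, b) ∈ A.1) h
    simpa using this

/-- Surjectivity serves only the tie: it makes the last two points of `T` go to the last two of `S`.
-/
theorem isNCChain_pull {k s : ℕ} {S T : Finset ℕ} {g : ℕ → ℕ} (hg : ∀ a ∈ T, g a ∈ S)
    (hmono : ∀ a ∈ T, ∀ b ∈ T, a < b → g a < g b) (hsurj : ∀ c ∈ S, ∃ a ∈ T, g a = c)
    {r : ℕ → ℕ → ℕ → Prop} (h : IsNCChain k S r ∧ IsTied k s S r) :
    IsNCChain k T (fun t a b => a ∈ T ∧ b ∈ T ∧ r t (g a) (g b)) ∧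
      IsTied k s T (fun t a b => a ∈ T ∧ b ∈ T ∧ r t (g a) (g b)) := by
  obtain ⟨h, h'⟩ := h
  refine ⟨⟨?_, ?_, ?_, ?_, ?_, ?_⟩, ?_⟩
  · rintro t a b ⟨ha, hb, hr⟩
    exact ⟨(h.supp hr).1, ha, hb⟩
  · intro t a ht ha
    exact ⟨ha, ha, h.refl ht (hg a ha)⟩
  · rintro t a b ⟨ha, hb, hr⟩
    exact ⟨hb, ha, h.symm hr⟩
  · rintro t a b c ⟨ha, hb, hr⟩ ⟨_, hc, hr'⟩
    exact ⟨ha, hc, h.trans hr hr'⟩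
  · rintro t a b c d ⟨ha, hc, hr⟩ ⟨hb, hd, hr'⟩ hab hbc hcd
    exact ⟨ha, hb, h.noncross hr hr' (hmono _ ha _ hb hab) (hmono _ hb _ hc hbc)
      (hmono _ hc _ hd hcd)⟩
  · rintro t u a b ⟨ha, hb, hr⟩ htu hu
    exact ⟨ha, hb, h.mono hr htu hu⟩
  · intro t x y hst ht hx hy hxy hz
    refine ⟨hx, hy, h' t _ _ hst ht (hg x hx) (hg y hy) (hmono _ hx _ hy hxy) ?_⟩
    intro c hc
    obtain ⟨a, ha, rfl⟩ := hsurj c hc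
    rcases hz a ha with h1 | rfl
    · rcases h1.lt_or_eq with h1 | rfl
      · exact Or.inl (hmono _ ha _ hx h1).le
      · exact Or.inl le_rfl
    · exact Or.inr rfl

theorem card_tiedChain_congr (k s : ℕ) {S T : Finset ℕ} (hST : S.card = T.card) :
    Nat.card (TiedChain k s S) = Nat.card (TiedChain k s T) := by
  classical
  let e : S ≃o T := (S.orderIsoOfFin hST).symm.trans (T.orderIsoOfFin rfl)
  let f : ℕ → ℕ := fun a => if h : a ∈ S then e ⟨a, h⟩ else 0
  let g : ℕ → ℕ := fun a => if h : a ∈ T then e.symm ⟨a, h⟩ else 0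
  have hf : ∀ a ∈ S, f a ∈ T := fun a ha => by simp [f, ha]
  have hg : ∀ a ∈ T, g a ∈ S := fun a ha => by simp [g, ha]
  have hgf : ∀ a ∈ S, g (f a) = a := fun a ha => by simp [f, g, ha]
  have hfg : ∀ a ∈ T, f (g a) = a := fun a ha => by simp [f, g, ha]
  have hfm : ∀ a ∈ S, ∀ b ∈ S, a < b → f a < f b := fun a ha b hb hab => by
    simp only [f, ha, hb, dif_pos]
    exact e.strictMono hab
  have hgm : ∀ a ∈ T, ∀ b ∈ T, a < b → g a < g b := fun a ha b hb hab => by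
    simp only [g, ha, hb, dif_pos]
    exact e.symm.strictMono hab
  refine Nat.card_congr
    { toFun := fun r => ⟨_, isNCChain_pull hg hgm (fun c hc => ⟨f c, hf c hc, hgf c hc⟩) r.2⟩
      invFun := fun r => ⟨_, isNCChain_pull hf hfm (fun c hc => ⟨g c, hg c hc, hfg c hc⟩) r.2⟩
      left_inv := ?_
      right_inv := ?_ }
  · rintro ⟨r, hr, hr'⟩
    apply Subtype.ext
    funext t a b
    apply propext
    constructor
    · rintro ⟨ha, hb, _, _, h⟩
      simpa only [hgf a ha, hgf b hb] using h
    · intro h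
      obtain ⟨_, ha, hb⟩ := hr.supp h
      refine ⟨ha, hb, hf a ha, hf b hb, ?_⟩
      simpa only [hgf a ha, hgf b hb] using h
  · rintro ⟨r, hr, hr'⟩
    apply Subtype.ext
    funext t a b
    apply propext
    constructor
    · rintro ⟨ha, hb, _, _, h⟩
      simpa only [hfg a ha, hfg b hb] using h
    · intro h
      obtain ⟨_, ha, hb⟩ := hr.supp h
      refine ⟨ha, hb, hg a ha, hg b hb, ?_⟩
      simpa only [hfg a ha, hfg b hb] using h

/-! ### Cutting and gluing chains. -/

/-- The restriction of a chain to a subset. -/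
def restrictRel (T : Finset ℕ) (r : ℕ → ℕ → ℕ → Prop) : ℕ → ℕ → ℕ → Prop :=
  fun t a b => a ∈ T ∧ b ∈ T ∧ r t a b

theorem IsNCChain.restrict {k : ℕ} {S T : Finset ℕ} {r : ℕ → ℕ → ℕ → Prop}
    (h : IsNCChain k S r) (hT : T ⊆ S) : IsNCChain k T (restrictRel T r) where
  supp := fun ⟨ha, hb, hr⟩ => ⟨(h.supp hr).1, ha, hb⟩
  refl := fun ht ha => ⟨ha, ha, h.refl ht (hT ha)⟩
  symm := fun ⟨ha, hb, hr⟩ => ⟨hb, ha, h.symm hr⟩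
  trans := fun ⟨ha, _, hr⟩ ⟨_, hc, hr'⟩ => ⟨ha, hc, h.trans hr hr'⟩
  noncross := fun ⟨ha, _, hr⟩ ⟨hb, _, hr'⟩ h1 h2 h3 => ⟨ha, hb, h.noncross hr hr' h1 h2 h3⟩
  mono := fun ⟨ha, hb, hr⟩ h1 h2 => ⟨ha, hb, h.mono hr h1 h2⟩

/-- The union of two chains, on `range i ∪ {n}` and on `Ico i n`, in which at the levels `t ≥ s`
the classes of `n` and `n - 1` are merged. -/
def glueRel (s i n : ℕ) (r₁ r₂ : ℕ → ℕ → ℕ → Prop) : ℕ → ℕ → ℕ → Prop :=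
  fun t a b => r₁ t a b ∨ r₂ t a b ∨
    (s ≤ t ∧ i < n ∧ (r₁ t a n ∧ r₂ t b (n - 1) ∨ r₂ t a (n - 1) ∧ r₁ t b n))

/-- The outer part of `range (n + 1)` in the splitting at `i`. -/
abbrev outer (i n : ℕ) : Finset ℕ := insert n (Finset.range i)

theorem mem_outer {i n a : ℕ} : a ∈ outer i n ↔ a = n ∨ a < i := by simp [outer]

section glue

variable {k s i n : ℕ} {r₁ r₂ : ℕ → ℕ → ℕ → Prop}

theorem restrict_outer_glue (h₁ : IsNCChain k (outer i n) r₁)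
    (h₂ : IsNCChain k (Finset.Ico i n) r₂) :
    restrictRel (outer i n) (glueRel s i n r₁ r₂) = r₁ := by
  funext t a b
  apply propext
  have e1 := fun x y (h : r₁ t x y) => h₁.supp h
  have e2 := fun x y (h : r₂ t x y) => h₂.supp h
  simp only [mem_outer, Finset.mem_Ico] at e1 e2
  simp only [restrictRel, glueRel, mem_outer]
  grind

theorem restrict_inner_glue (h₁ : IsNCChain k (outer i n) r₁)
    (h₂ : IsNCChain k (Finset.Ico i n) r₂) :
    restrictRel (Finset.Ico i n) (glueRel s i n r₁ r₂) = r₂ := by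
  funext t a b
  apply propext
  have e1 := fun x y (h : r₁ t x y) => h₁.supp h
  have e2 := fun x y (h : r₂ t x y) => h₂.supp h
  simp only [mem_outer, Finset.mem_Ico] at e1 e2
  simp only [restrictRel, glueRel, Finset.mem_Ico]
  grind

/-- The inner part is an interval, so its classes cannot cross outer ones; merging the classes of
the neighbours `n - 1` and `n` creates no crossing either. -/
theorem isNCChain_glue (hi : i ≤ n) (h₁ : IsNCChain k (outer i n) r₁)
    (h₂ : IsNCChain k (Finset.Ico i n) r₂) :
    IsNCChain k (Finset.range (n + 1)) (glueRel s i n r₁ r₂) := by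
  have e1 := fun t x y (h : r₁ t x y) => h₁.supp h
  have e2 := fun t x y (h : r₂ t x y) => h₂.supp h
  have l1 := fun t x (h : t < k) => h₁.refl (t := t) (a := x) h
  have l2 := fun t x (h : t < k) => h₂.refl (t := t) (a := x) h
  have s1 := fun t x y => h₁.symm (t := t) (a := x) (b := y)
  have s2 := fun t x y => h₂.symm (t := t) (a := x) (b := y)
  have t1 := fun t x y z => h₁.trans (t := t) (a := x) (b := y) (c := z)
  have t2 := fun t x y z => h₂.trans (t := t) (a := x) (b := y) (c := z)
  have m1 := fun t u x y => h₁.mono (t := t) (u := u) (a := x) (b := y)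
  have m2 := fun t u x y => h₂.mono (t := t) (u := u) (a := x) (b := y)
  simp only [mem_outer, Finset.mem_Ico] at e1 e2 l1 l2
  refine ⟨?_, ?_, ?_, ?_, ?_, ?_⟩
  · intro t a b
    simp only [glueRel, Finset.mem_range]
    grind
  · intro t a
    simp only [glueRel, Finset.mem_range]
    grind
  · intro t a b
    simp only [glueRel]
    grind
  · intro t a b c
    simp only [glueRel]
    grind
  · intro t a b c d
    have c1 := fun x y z w => h₁.noncross (t := t) (a := x) (b := y) (c := z) (d := w)
    have c2 := fun x y z w => h₂.noncross (t := t) (a := x) (b := y) (c := z) (d := w)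
    simp only [glueRel]
    rintro (h | h | ⟨hs, hin, h | h⟩) (h' | h' | ⟨hs', hin', h' | h'⟩) hab hbc hcd <;> grind
  · intro t u a b
    simp only [glueRel]
    grind

theorem isTied_glue (hi : i ≤ n) (h₁ : IsNCChain k (outer i n) r₁)
    (h₁' : IsTied k s (outer i n) r₁) (h₂ : IsNCChain k (Finset.Ico i n) r₂) :
    IsTied k s (Finset.range (n + 1)) (glueRel s i n r₁ r₂) := by
  intro t x y hst ht hx hy hxy hz
  simp only [Finset.mem_range] at hx hy hz
  have hyn : y = n := by have := hz n (by omega); omega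
  have hxn : x = n - 1 := by have := hz (n - 1) (by omega); omega
  subst hyn hxn
  rcases hi.lt_or_eq with hi | rfl
  · refine Or.inr (Or.inr ⟨hst, hi, Or.inr ⟨h₂.refl ht ?_, h₁.refl ht ?_⟩⟩)
    · simp only [Finset.mem_Ico]; omega
    · simp
  · left
    apply h₁' t _ _ hst ht <;> grind [mem_outer]

/-- A chain is determined by its restrictions to the two parts of a splitting which it respects. -/
theorem glue_restrict {r : ℕ → ℕ → ℕ → Prop} (hi : i ≤ n)
    (h : IsNCChain k (Finset.range (n + 1)) r) (h' : IsTied k s (Finset.range (n + 1)) r)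
    (hpred : ∀ t, s ≤ t → t < k → 0 < i → r t (i - 1) n)
    (hsep : ∀ t x y, t < s → x ∈ outer i n → y ∈ Finset.Ico i n → ¬ r t x y) :
    glueRel s i n (restrictRel (outer i n) r) (restrictRel (Finset.Ico i n) r) = r := by
  have tie : ∀ t, s ≤ t → t < k → 0 < n → r t (n - 1) n := by
    intro t hst ht hn
    apply h' t _ _ hst ht <;> grind
  -- As `i - 1` is related to `n`, noncrossing forces a class joining some `x < i` to the inner part
  -- to contain both.
  have key : ∀ t x y, t < k → s ≤ t → (x = n ∨ x < i) → i ≤ y → y < n → r t x y → r t x n := by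
    intro t x y ht hst hx hy hyn hr
    rcases hx with rfl | hx
    · exact h.refl ht (by simp)
    have hp := hpred t hst ht (by omega)
    rcases (show x ≤ i - 1 by omega).lt_or_eq with hlt | rfl
    · exact h.trans (h.noncross hr hp hlt (by omega) hyn) hp
    · exact hp
  have mixed : ∀ t x y, (x = n ∨ x < i) → i ≤ y → y < n → r t x y →
      s ≤ t ∧ r t x n ∧ r t y (n - 1) := by
    intro t x y hx hy hyn hr
    have ht := (h.supp hr).1
    have hst : s ≤ t := by
      by_contra hlt
      exact hsep t x y (by omega) (mem_outer.2 hx) (Finset.mem_Ico.2 ⟨hy, hyn⟩) hr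
    have hxn := key t x y ht hst hx hy hyn hr
    exact ⟨hst, hxn, h.trans (h.trans (h.symm hr) hxn) (h.symm (tie t hst ht (by omega)))⟩
  funext t a b
  apply propext
  simp only [glueRel, restrictRel, mem_outer, Finset.mem_Ico]
  constructor
  · rintro (hr | hr | ⟨_, _, ⟨⟨_, _, h1⟩, _, _, h2⟩ | ⟨⟨_, _, h1⟩, _, _, h2⟩⟩)
    · exact hr.2.2
    · exact hr.2.2
    · exact h.trans h1 (h.trans (h.symm (tie t ‹_› (h.supp h1).1 (by omega))) (h.symm h2))
    · exact h.trans h1 (h.trans (tie t ‹_› (h.supp h1).1 (by omega)) (h.symm h2))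
  · intro hr
    obtain ⟨ht, ha, hb⟩ := h.supp hr
    rw [Finset.mem_range] at ha hb
    rcases (show (a = n ∨ a < i) ∨ (i ≤ a ∧ a < n) by omega) with ha | ha <;>
      rcases (show (b = n ∨ b < i) ∨ (i ≤ b ∧ b < n) by omega) with hb | hb
    · exact Or.inl ⟨ha, hb, hr⟩
    · obtain ⟨h1, h2, h3⟩ := mixed t a b ha hb.1 hb.2 hr
      exact Or.inr (Or.inr ⟨h1, by omega, Or.inl ⟨⟨ha, by simp, h2⟩, hb, by omega, h3⟩⟩)
    · obtain ⟨h1, h2, h3⟩ := mixed t b a hb ha.1 ha.2 (h.symm hr)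
      exact Or.inr (Or.inr ⟨h1, by omega, Or.inr ⟨⟨ha, by omega, h3⟩, hb, by simp, h2⟩⟩)
    · exact Or.inr (Or.inl ⟨ha, hb, hr⟩)

end glue

theorem IsNCChain.isTied {k s : ℕ} {S : Finset ℕ} {r : ℕ → ℕ → ℕ → Prop} (hs : k ≤ s) :
    IsTied k s S r := fun _ _ _ h h' => by omega

/-! ### Recursion and generating function. -/

/-- The number of chains of length `k` on an `n`-element set. -/
noncomputable def chainCount (k n : ℕ) : ℕ := Nat.card (TiedChain k k (Finset.range n))

theorem card_tiedChain_zero (k n : ℕ) :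
    Nat.card (TiedChain k 0 (Finset.range (n + 1))) = chainCount k n := by
  have h₀ : IsNCChain k (outer 0 n) (fun t a b => t < k ∧ a = n ∧ b = n) := by
    refine ⟨?_, ?_, ?_, ?_, ?_, ?_⟩ <;> grind [mem_outer]
  have h₀' : IsTied k 0 (outer 0 n) (fun t a b => t < k ∧ a = n ∧ b = n) := by
    intro t x y _ _ hx hy hxy
    rw [mem_outer] at hx hy
    omega
  have hI : Finset.range n = Finset.Ico 0 n := by simp
  unfold chainCount
  rw [hI]
  symm
  refine Nat.card_eq_of_bijective
    (fun r : TiedChain k k (Finset.Ico 0 n) => (⟨glueRel 0 0 n _ r.1,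
      isNCChain_glue n.zero_le h₀ r.2.1, isTied_glue n.zero_le h₀ h₀' r.2.1⟩ :
        TiedChain k 0 (Finset.range (n + 1)))) ⟨?_, ?_⟩
  · intro r r' h
    have := congrArg (fun r => restrictRel (Finset.Ico 0 n) r.1) h
    simp only [restrict_inner_glue h₀ r.2.1, restrict_inner_glue h₀ r'.2.1] at this
    exact Subtype.ext this
  · rintro ⟨r, hr, hr'⟩
    refine ⟨⟨restrictRel (Finset.Ico 0 n) r, hr.restrict (by intro x; simp; omega),
      IsNCChain.isTied le_rfl⟩, Subtype.ext ?_⟩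
    have key : restrictRel (outer 0 n) r = fun t a b => t < k ∧ a = n ∧ b = n := by
      funext t a b
      apply propext
      simp only [restrictRel, mem_outer]
      constructor
      · rintro ⟨ha, hb, h⟩
        exact ⟨(hr.supp h).1, by omega, by omega⟩
      · rintro ⟨ht, rfl, rfl⟩
        exact ⟨Or.inl rfl, Or.inl rfl, hr.refl ht (by simp)⟩
    have := glue_restrict n.zero_le hr hr' (by omega) (by omega)
    rwa [key] at this

/-- By maximality of the cut and noncrossing, no class at levels up to `s` meets both parts; at
higher levels the tie dictates the merging, so the two restrictions determine the chain. -/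
theorem card_tiedChain_succ {k s : ℕ} (hs : s < k) (n : ℕ) :
    Nat.card (TiedChain k (s + 1) (Finset.range (n + 1))) =
      ∑ i ∈ Finset.range (n + 1),
        Nat.card (TiedChain k s (Finset.range (i + 1))) * chainCount k (n - i) := by
  have hle : ∀ i : Fin (n + 1), (i : ℕ) ≤ n := fun i => by omega
  have tied_mono : ∀ {S r}, IsTied k s S r → IsTied k (s + 1) S r :=
    fun h t x y hst => h t x y (by omega)
  have tie : ∀ {i : ℕ} {r}, i ≤ n → 0 < i → IsTied k s (outer i n) r → r s (i - 1) n := by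
    intro i r hi h0 h
    apply h s _ _ le_rfl hs <;> grind [mem_outer]
  let Φ : (Σ i : Fin (n + 1), TiedChain k s (outer i n) × TiedChain k k (Finset.Ico (i : ℕ) n)) →
      TiedChain k (s + 1) (Finset.range (n + 1)) := fun p =>
    ⟨glueRel (s + 1) p.1 n p.2.1.1 p.2.2.1,
      isNCChain_glue (hle p.1) p.2.1.2.1 p.2.2.2.1,
      isTied_glue (hle p.1) p.2.1.2.1 (tied_mono p.2.1.2.2) p.2.2.2.1⟩
  -- The cut is recoverable: gluing at `j` relates `j - 1` to `n` at level `s`, whereas gluing at `i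
  -- < j` puts `j - 1` in the inner part, not merged with `n` at that level.
  have inj_lt : ∀ p q, Φ p = Φ q → ¬ (p.1 : ℕ) < q.1 := by
    rintro ⟨i, r₁, r₂⟩ ⟨j, r₁', r₂'⟩ h hij
    simp only at hij
    have hj : (j : ℕ) ≤ n := hle j
    have h1 : glueRel (s + 1) j n r₁'.1 r₂'.1 s (j - 1) n :=
      Or.inl (tie hj (by omega) r₁'.2.2)
    have h2 : glueRel (s + 1) i n r₁.1 r₂.1 s (j - 1) n := by
      have := congrArg (fun r => r.1 s (j - 1) n) h
      exact this.mpr h1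
    rcases h2 with h2 | h2 | h2
    · have := (r₁.2.1.supp h2).2.1
      rw [mem_outer] at this
      omega
    · have := (r₂.2.1.supp h2).2.2
      rw [Finset.mem_Ico] at this
      omega
    · omega
  have hbij : Function.Bijective Φ := by
    constructor
    · intro p q h
      have hpq : p.1 = q.1 := by
        have := inj_lt p q h
        have := inj_lt q p h.symm
        exact Fin.ext (by omega)
      obtain ⟨i, r₁, r₂⟩ := p
      obtain ⟨j, r₁', r₂'⟩ := q
      obtain rfl : i = j := hpq
      have h1 := congrArg (fun r => restrictRel (outer i n) r.1) h
      have h2 := congrArg (fun r => restrictRel (Finset.Ico (i : ℕ) n) r.1) h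
      simp only [Φ, restrict_outer_glue r₁.2.1 r₂.2.1, restrict_outer_glue r₁'.2.1 r₂'.2.1] at h1
      simp only [Φ, restrict_inner_glue r₁.2.1 r₂.2.1, restrict_inner_glue r₁'.2.1 r₂'.2.1] at h2
      rw [Subtype.ext h1, Subtype.ext h2]
    · classical
      rintro ⟨r, hr, hr'⟩
      -- The shift by one lets the default value 0 of `Nat.findGreatest` mean that no such point
      -- exists.
      obtain ⟨i, hi, hpred, hmax⟩ : ∃ i ≤ n, (0 < i → r s (i - 1) n) ∧
          ∀ y, i ≤ y → y < n → ¬ r s y n :=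
        ⟨Nat.findGreatest (fun i => r s (i - 1) n) n, Nat.findGreatest_le n,
          fun h => Nat.findGreatest_of_ne_zero (P := fun i => r s (i - 1) n) rfl h.ne',
          fun y hy hyn h => Nat.findGreatest_is_greatest (P := fun i => r s (i - 1) n)
            (k := y + 1) (Nat.lt_succ_of_le hy) hyn h⟩
      have ho : outer i n ⊆ Finset.range (n + 1) := by
        intro x
        rw [mem_outer, Finset.mem_range]
        omega
      have hI : Finset.Ico i n ⊆ Finset.range (n + 1) := by
        intro x
        rw [Finset.mem_Ico, Finset.mem_range]
        omega
      have htied : IsTied k s (outer i n) (restrictRel (outer i n) r) := by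
        intro t x y hst ht hx hy hxy hz
        have hyn : y = n := by
          rw [mem_outer] at hx hy
          have := hz n (by simp)
          omega
        rw [mem_outer] at hx
        have hxi : x = i - 1 := by
          have := hz (i - 1) (mem_outer.2 (by omega))
          omega
        refine ⟨mem_outer.2 hx, hy, ?_⟩
        rw [hyn, hxi]
        exact hr.mono (hpred (by omega)) hst ht
      refine ⟨⟨⟨i, by omega⟩, ⟨_, hr.restrict ho, htied⟩,
        ⟨_, hr.restrict hI, IsNCChain.isTied le_rfl⟩⟩, Subtype.ext ?_⟩
      refine glue_restrict hi hr hr' (fun t hst ht h0 => hr.mono (hpred h0) (by omega) ht) ?_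
      intro t x y ht hx hy h
      replace h := hr.mono h (show t ≤ s by omega) hs
      replace hx : x = n ∨ x < i := mem_outer.1 hx
      replace hy : i ≤ y ∧ y < n := Finset.mem_Ico.1 hy
      rcases hx with rfl | hx
      · exact hmax y hy.1 hy.2 (hr.symm h)
      have hp := hpred (by omega)
      have hxn : r s x n := by
        rcases (show x ≤ i - 1 by omega).lt_or_eq with hlt | rfl
        · exact hr.trans (hr.noncross h hp hlt (by omega) hy.2) hp
        · exact hp
      exact hmax y hy.1 hy.2 (hr.trans (hr.symm h) hxn)
  rw [← Nat.card_eq_of_bijective Φ hbij, Nat.card_sigma, Finset.sum_range]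
  refine Finset.sum_congr rfl fun i _ => ?_
  rw [Nat.card_prod]
  congr 1
  · apply card_tiedChain_congr
    rw [Finset.card_insert_of_notMem (by have := hle i; simp; omega)]
    simp
  · apply card_tiedChain_congr
    simp

open PowerSeries in
theorem mk_chainCount (k : ℕ) :
    (mk (chainCount k) : PowerSeries ℕ) = 1 + X * mk (chainCount k) ^ (k + 1) := by
  have hpow : ∀ s ≤ k, ((mk fun n => Nat.card (TiedChain k s (Finset.range (n + 1)))) :
      PowerSeries ℕ) = mk (chainCount k) ^ (s + 1) := by
    intro s
    induction s with
    | zero =>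
      intro _
      rw [zero_add, pow_one]
      ext n
      rw [coeff_mk, coeff_mk, card_tiedChain_zero]
    | succ s ih =>
      intro hs
      rw [pow_succ, ← ih (by omega)]
      ext n
      rw [coeff_mk, card_tiedChain_succ (by omega), coeff_mul,
        Finset.Nat.sum_antidiagonal_eq_sum_range_succ_mk]
      simp
  rw [← hpow k le_rfl]
  ext n
  cases n with
  | zero =>
    have : chainCount k 0 = 1 := by
      rw [chainCount, Nat.card_eq_one_iff_unique]
      refine ⟨⟨fun r r' => Subtype.ext ?_⟩, ⟨fun _ _ _ => False, ?_, IsNCChain.isTied le_rfl⟩⟩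
      · funext t a b
        apply propext
        exact ⟨fun h => by simpa using (r.2.1.supp h).2.1,
          fun h => by simpa using (r'.2.1.supp h).2.1⟩
      · constructor <;> simp
    simp [this]
  | succ n =>
    rw [map_add, coeff_succ_X_mul, coeff_mk, coeff_mk, coeff_one]
    simp [chainCount]

/-! ### Coefficient extraction. -/

open PowerSeries in
/-- The coefficients of the powers of a series `F` with `F = 1 + X F ^ m`. -/
theorem coeff_pow_of_eq_one_add_X_mul_pow {m : ℕ} (hm : 0 < m) {F : PowerSeries ℕ}
    (hF : F = 1 + X * F ^ m) (n r : ℕ) :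
    (m * n + r) * coeff n (F ^ r) = r * (m * n + r).choose n := by
  have hrec : ∀ r, F ^ (r + 1) = F ^ r + X * F ^ (r + m) := by
    intro r
    calc F ^ (r + 1) = F ^ r * F := pow_succ _ _
      _ = F ^ r * (1 + X * F ^ m) := by rw [← hF]
      _ = _ := by ring
  have h0 : constantCoeff F = 1 := by
    rw [hF]
    simp
  induction n generalizing r with
  | zero => simp [h0]
  | succ n ihn =>
    induction r with
    | zero => simp [coeff_one]
    | succ r ihr =>
      have h1 := ihn (r + m)
      rw [hrec, map_add, coeff_succ_X_mul]
      -- Both terms of the recurrence carry the same factor `N`, so only binomial identities remain.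
      have hN : m * n + (r + m) = m * (n + 1) + r := by ring
      rw [hN] at h1
      rw [← add_assoc]
      have hle : n + 1 ≤ m * (n + 1) + r := by nlinarith
      have hpos : 0 < m * (n + 1) + r := by omega
      have e2 : ((m * (n + 1) + r : ℕ) : ℤ) = m * (n + 1) + r := by push_cast; ring
      generalize m * (n + 1) + r = N at *
      generalize coeff (n + 1) (F ^ r) = c at *
      generalize coeff n (F ^ (r + m)) = d at *
      have c1 := Nat.choose_succ_right_eq N n
      have c2 := Nat.add_one_mul_choose_eq N n
      generalize (N + 1).choose (n + 1) = u at *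
      generalize N.choose (n + 1) = v at *
      generalize N.choose n = w at *
      zify [show n ≤ N by omega] at *
      have hNn : (N : ℤ) * (n + 1) ≠ 0 := by positivity
      apply mul_left_cancel₀ hNn
      linear_combination (n + 1 : ℤ) * (N + 1) * ihr + (n + 1 : ℤ) * (N + 1) * h1 +
        (N + 1 : ℤ) * r * c1 + (N : ℤ) * (r + 1) * c2 - (N + 1 : ℤ) * w * e2

/-! ### From partitions to equivalence relations. -/

/-- Two elements lie in the same block of a partition. -/
def SameBlock {s : Finset ℕ} (P : Finpartition s) (a b : ℕ) : Prop :=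
  ∃ B ∈ P.parts, a ∈ B ∧ b ∈ B

theorem sameBlock_iff_of_mem {s : Finset ℕ} {P : Finpartition s} {B : Finset ℕ}
    (hB : B ∈ P.parts) {a b : ℕ} (ha : a ∈ B) : SameBlock P a b ↔ b ∈ B := by
  constructor
  · rintro ⟨C, hC, haC, hbC⟩
    rwa [P.eq_of_mem_parts hB hC ha haC]
  · exact fun hb => ⟨B, hB, ha, hb⟩

theorem SameBlock.symm {s : Finset ℕ} {P : Finpartition s} {a b : ℕ} :
    SameBlock P a b → SameBlock P b a := fun ⟨B, hB, ha, hb⟩ => ⟨B, hB, hb, ha⟩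

theorem SameBlock.trans {s : Finset ℕ} {P : Finpartition s} {a b c : ℕ}
    (h : SameBlock P a b) (h' : SameBlock P b c) : SameBlock P a c := by
  obtain ⟨B, hB, ha, hb⟩ := h
  exact ⟨B, hB, ha, (sameBlock_iff_of_mem hB hb).1 h'⟩

theorem le_iff_sameBlock {s : Finset ℕ} {P Q : Finpartition s} :
    P ≤ Q ↔ ∀ a b, SameBlock P a b → SameBlock Q a b := by
  constructor
  · rintro h a b ⟨B, hB, ha, hb⟩
    obtain ⟨C, hC, hBC⟩ := h hB
    exact ⟨C, hC, hBC ha, hBC hb⟩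
  · intro h B hB
    obtain ⟨a, ha⟩ := P.nonempty_of_mem_parts hB
    obtain ⟨C, hC, haC, -⟩ := h a a ⟨B, hB, ha, ha⟩
    exact ⟨C, hC, fun b hb => (sameBlock_iff_of_mem hC haC).1 (h a b ⟨B, hB, ha, hb⟩)⟩

/-- It makes no difference whether only arcs, or arbitrary pairs of related elements, are
forbidden to cross. -/
theorem isPlanar_iff {s : Finset ℕ} {P : Finpartition s} :
    IsPlanar P ↔ ∀ a b c d, SameBlock P a c → SameBlock P b d → a < b → b < c → c < d →
      SameBlock P a b := by
  constructor
  · rintro h a b c d ⟨A, hA, ha, hc⟩ ⟨B, hB, hb, hd⟩ hab hbc hcd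
    by_contra hne
    have hdisj : ∀ x ∈ A, x ∉ B := by
      intro x hx hx'
      exact hne ⟨A, hA, ha, by rwa [P.eq_of_mem_parts hA hB hx hx']⟩
    -- The arc `(i, j)` of `A` passes over `b`; the arc `(k, l)` of `B` passes over `j`, and `b ≤ k`
    -- gives `i < k`.
    obtain ⟨i, hi, hi'⟩ := (A.filter (· < b)).exists_max_image id ⟨a, by simp [ha, hab]⟩
    obtain ⟨j, hj, hj'⟩ := (A.filter (b < ·)).exists_min_image id ⟨c, by simp [hc, hbc]⟩
    obtain ⟨k, hk, hk'⟩ := (B.filter (· < j)).exists_max_image id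
      ⟨b, by simp only [Finset.mem_filter] at hj ⊢; exact ⟨hb, hj.2⟩⟩
    obtain ⟨l, hl, hl'⟩ := (B.filter (j < ·)).exists_min_image id
      ⟨d, by
        have := hj' c (by simp [hc, hbc])
        simp only [id, Finset.mem_filter] at this ⊢
        exact ⟨hd, by omega⟩⟩
    simp only [Finset.mem_filter, id, and_imp] at hi hi' hj hj' hk hk' hl hl'
    have hbk := hk' b hb hj.2
    refine h i j k l ⟨A, hA, hi.1, hj.1, by omega, ?_⟩ ⟨B, hB, hk.1, hl.1, by omega, ?_⟩
      ⟨by omega, hk.2, hl.2⟩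
    · rintro x hx ⟨h1, h2⟩
      rcases lt_trichotomy x b with h3 | rfl | h3
      · have := hi' x hx h3
        omega
      · exact hdisj x hx hb
      · have := hj' x hx h3
        omega
    · rintro x hx ⟨h1, h2⟩
      rcases lt_trichotomy x j with h3 | rfl | h3
      · have := hk' x hx h3
        omega
      · exact hdisj x hj.1 hx
      · have := hl' x hx h3
        omega
  · rintro h i j k l ⟨A, hA, hi, hj, hij, hA'⟩ ⟨B, hB, hk, hl, -, -⟩ ⟨h1, h2, h3⟩
    have := h i k j l ⟨A, hA, hi, hj⟩ ⟨B, hB, hk, hl⟩ h1 h2 h3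
    exact hA' k ((sameBlock_iff_of_mem hA hi).1 this) ⟨h1, h2⟩

/-- Every relation that is an equivalence on `s` is that of a partition of `s`. -/
theorem exists_finpartition_sameBlock {s : Finset ℕ} {r : ℕ → ℕ → Prop}
    (hsupp : ∀ a b, r a b → a ∈ s ∧ b ∈ s) (hrefl : ∀ a ∈ s, r a a)
    (hsymm : ∀ a b, r a b → r b a) (htrans : ∀ a b c, r a b → r b c → r a c) :
    ∃ P : Finpartition s, ∀ a b, SameBlock P a b ↔ r a b := by
  classical
  -- Equality is added to get reflexivity outside `s`.
  let S : Setoid ℕ :=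
    { r := fun a b => a = b ∨ r a b
      iseqv :=
        { refl := fun a => Or.inl rfl
          symm := by
            rintro a b (rfl | h)
            · exact Or.inl rfl
            · exact Or.inr (hsymm _ _ h)
          trans := by
            rintro a b c (rfl | h) (rfl | h')
            · exact Or.inl rfl
            · exact Or.inr h'
            · exact Or.inr h
            · exact Or.inr (htrans _ _ _ h h') } }
  refine ⟨Finpartition.ofSetSetoid S s, fun a b => ?_⟩
  rw [SameBlock, ← Finpartition.mem_part_iff_exists, Finpartition.mem_part_ofSetSetoid_iff_rel]
  constructor
  · rintro ⟨hb, _, rfl | h⟩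
    · exact hrefl _ hb
    · exact hsymm _ _ h
  · intro h
    exact ⟨(hsupp _ _ h).2, (hsupp _ _ h).1, Or.inr (hsymm _ _ h)⟩

theorem TuplePlanarPartition.mono {k n : ℕ} (p : TuplePlanarPartition k n) {t u : ℕ}
    (htu : t ≤ u) (hu : u < k) : p.part ⟨t, by omega⟩ ≤ p.part ⟨u, hu⟩ := by
  induction u, htu using Nat.le_induction with
  | base => exact le_rfl
  | succ u htu ih => exact (ih (by omega)).trans (p.refines ⟨u, by omega⟩ ⟨u + 1, hu⟩ rfl)

theorem card_tuplePlanarPartition (k n : ℕ) :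
    Nat.card (TuplePlanarPartition k n) = chainCount k n := by
  have hcard : chainCount k n = Nat.card (TiedChain k k (Finset.Icc 1 n)) :=
    card_tiedChain_congr k k (by simp)
  rw [hcard]
  refine Nat.card_eq_of_bijective
    (fun p : TuplePlanarPartition k n => (⟨fun t a b => ∃ ht : t < k, SameBlock (p.part ⟨t, ht⟩) a b,
      ?_, IsNCChain.isTied le_rfl⟩ : TiedChain k k (Finset.Icc 1 n))) ⟨?_, ?_⟩
  · refine ⟨?_, ?_, ?_, ?_, ?_, ?_⟩
    · rintro t a b ⟨ht, B, hB, ha, hb⟩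
      exact ⟨ht, (p.part _).le hB ha, (p.part _).le hB hb⟩
    · intro t a ht ha
      obtain ⟨B, hB, haB⟩ := (p.part ⟨t, ht⟩).exists_mem ha
      exact ⟨ht, B, hB, haB, haB⟩
    · rintro t a b ⟨ht, h⟩
      exact ⟨ht, h.symm⟩
    · rintro t a b c ⟨ht, h⟩ ⟨_, h'⟩
      exact ⟨ht, h.trans h'⟩
    · rintro t a b c d ⟨ht, h⟩ ⟨_, h'⟩ h1 h2 h3
      exact ⟨ht, isPlanar_iff.1 (p.planar ⟨t, ht⟩) a b c d h h' h1 h2 h3⟩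
    · rintro t u a b ⟨ht, h⟩ htu hu
      exact ⟨hu, le_iff_sameBlock.1 (p.mono htu hu) a b h⟩
  · rintro ⟨P, hP, hP'⟩ ⟨Q, hQ, hQ'⟩ h
    have key : P = Q := by
      funext t
      have h1 : ∀ a b, SameBlock (P t) a b ↔ SameBlock (Q t) a b := by
        intro a b
        have := congrArg (fun r => r.1 t a b) h
        simpa using this
      exact le_antisymm (le_iff_sameBlock.2 fun a b => (h1 a b).1)
        (le_iff_sameBlock.2 fun a b => (h1 a b).2)
    subst key
    rfl
  · rintro ⟨r, hr, hr'⟩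
    have hex : ∀ t : Fin k, ∃ P : Finpartition (Finset.Icc 1 n), ∀ a b, SameBlock P a b ↔ r t a b :=
      fun t => exists_finpartition_sameBlock (fun a b h => (hr.supp h).2)
        (fun a => hr.refl t.2) (fun a b => hr.symm) (fun a b c => hr.trans)
    choose P hP using hex
    refine ⟨⟨P, fun t => isPlanar_iff.2 ?_, fun i j hij => le_iff_sameBlock.2 ?_⟩, Subtype.ext ?_⟩
    · intro a b c d h h' h1 h2 h3
      rw [hP] at *
      exact hr.noncross h h' h1 h2 h3
    · intro a b h
      rw [hP] at *
      exact hr.mono h (by omega) j.2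
    · funext t a b
      apply propext
      constructor
      · rintro ⟨ht, h⟩
        exact (hP _ a b).1 h
      · intro h
        exact ⟨(hr.supp h).1, (hP ⟨t, _⟩ a b).2 h⟩

open PowerSeries in
theorem corollary1 (m : ℕ) (hm : 1 < m) (n : ℕ) :
    (Nat.card (TuplePlanarPartition (m - 1) n) : ℚ) = fussCatalan m n := by
  have hF := mk_chainCount (m - 1)
  rw [Nat.sub_add_cancel hm.le] at hF
  have h := coeff_pow_of_eq_one_add_X_mul_pow (by omega) hF n 1
  rw [pow_one, coeff_mk, one_mul] at h
  rw [card_tuplePlanarPartition, fussCatalan, ← h]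
  have : (m : ℚ) * n + 1 ≠ 0 := by positivity
  push_cast
  field_simp
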